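/- Let $G=(V,E)$ be a finite simple graph, and let $(e_v)_{v\in V}$ be the canonical basis of $\mathbb{R}^V$. All polytopes are non-empty. The graphical zonotope $Z_G\subset\mathbb{R}^V$ is the Minkowski sum of the segments $[e_u,e_v]$ for all edges $\{u,v\}\in E$ (it is $\{0\}$ if $E=\varnothing$). Let $\mathbb{V}$ be the real vector space of virtual polytopes in $\mathbb{R}^V$: it is the Grothendieck group of polytopes under Minkowski addition, so that $P-Q=P'-Q'$ if and only if $P+Q'=P'+Q$, with the scalar multiplication $\lambda(P-Q)=\lambda P-\lambda Q$ for $\lambda\ge 0$ and $\lambda(P-Q)=(-\lambda)Q-(-\lambda)P$ for $\lambda<0$; a polytope $P$ is identified with $P-\{0\}$. A deformation of a polytope $P$ is a polytope $Q$ such that $Q+R=\lambda P$ for some polytope $R$ and some $\lambda\ge 0$, and the space $\mathbb{VD}(P)\subseteq\mathbb{V}$ of virtual deformations of $P$ is the linear span of the deformations of $P$. For $\varnothing\ne U\subseteq V$ let $\Delta_U=\mathrm{conv}\{e_u : u\in U\}$. For $h\in\mathbb{R}^{2^V}$ let $P_h=\{x\in\mathbb{R}^V : \sum_{v\in S}x_v-\sum_{v\notin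 S}x_v\le h_S \text{ for all } S\subseteq V\}$. A deformed permutahedron is a deformation of the graphical zonotope of the complete graph on $V$; each one is $P_k$ for a unique tight $k$, that is, one for which each of these inequalities is attained with equality on $P_k$. More generally, a virtual polytope $X$ is denoted by $P_h$ if $X=P_k-P_l$ for deformed permutahedra $P_k$, $P_l$ with $k$, $l$ tight and $h=k-l$. Theorem. (i) The dimension of $\mathbb{VD}(Z_G)$ is the number of non-empty subsets of $V$ that induce a clique of $G$. (ii) The polytopes $\Delta_K$, for all non-empty $K\subseteq V$ inducing a clique of $G$, form a linear basis of $\mathbb{VD}(Z_G)$. (iii) For each $S\subseteq V$ not inducing a clique of $G$, choose any pair $\{u_S,v_S\}\subseteq S$ of distinct non-adjacent vertices. Then the linear equations on $h\in\mathbb{R}^{2^V}$ $$h_\varnothing=-h_V,\qquad h_{S\setminus\{u_S\}}+h_{S\setminus\{v_S\}}=h_S+h_{S\setminus\{u_S,v_S\}}\quad\text{for each } S\subseteq V \text{ not inducing a clique of } G,$$ are linearly independent; each solution $h$ defines a unique virtual polytope $P_h$; the space $\mathbb{VD}(Z_G)$ is the set of the virtual polytopes $P_h$ for all solutions $h$;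 and each element of $\mathbb{VD}(Z_G)$ is $P_h$ for a unique $h$. -/

import Mathlib

open scoped NNReal Pointwise

noncomputable section

/-- A (non-empty) polytope in a real vector space: the convex hull of a non-empty finite set. -/
@[ext]
structure Polytope (E : Type*) [AddCommGroup E] [Module ℝ E] where
  carrier : Set E
  exists_finite' : ∃ s : Set E, s.Finite ∧ s.Nonempty ∧ convexHull ℝ s = carrier

namespace Polytope

variable {E : Type*} [AddCommGroup E] [Module ℝ E]

theorem convex (P : Polytope E) : Convex ℝ P.carrier := by
  obtain ⟨s, -, -, h⟩ := P.exists_finite'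
  exact h ▸ convex_convexHull ℝ s

theorem nonempty (P : Polytope E) : P.carrier.Nonempty := by
  obtain ⟨s, -, hs, h⟩ := P.exists_finite'
  exact h ▸ hs.convexHull

/-- The polytope reduced to the origin. -/
instance : Zero (Polytope E) :=
  ⟨⟨{0}, {0}, Set.finite_singleton 0, Set.singleton_nonempty 0, convexHull_singleton 0⟩⟩

/-- The Minkowski sum of two polytopes. -/
instance : Add (Polytope E) :=
  ⟨fun P Q => ⟨P.carrier + Q.carrier, by
    obtain ⟨s, hs, hs', h⟩ := P.exists_finite'
    obtain ⟨t, ht, ht', h'⟩ := Q.exists_finite'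
    exact ⟨s + t, hs.add ht, hs'.add ht', by rw [convexHull_add, h, h']⟩⟩⟩

/-- The dilation of a polytope by a non-negative factor. -/
instance : SMul ℝ≥0 (Polytope E) :=
  ⟨fun r P => ⟨(r : ℝ) • P.carrier, by
    obtain ⟨s, hs, hs', h⟩ := P.exists_finite'
    exact ⟨(r : ℝ) • s, hs.smul_set, hs'.smul_set, by rw [convexHull_smul, h]⟩⟩⟩

theorem carrier_zero : (0 : Polytope E).carrier = {0} := rfl

theorem carrier_add (P Q : Polytope E) : (P + Q).carrier = P.carrier + Q.carrier := rfl

theorem carrier_smul (r : ℝ≥0) (P : Polytope E) : (r • P).carrier = (r : ℝ) • P.carrier := rfl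

/-- Polytopes under Minkowski addition. -/
instance : AddCommMonoid (Polytope E) where
  add_assoc P Q R := Polytope.ext (add_assoc P.carrier Q.carrier R.carrier)
  zero_add P := Polytope.ext (by rw [carrier_add, carrier_zero, Set.singleton_zero, zero_add])
  add_zero P := Polytope.ext (by rw [carrier_add, carrier_zero, Set.singleton_zero, add_zero])
  add_comm P Q := Polytope.ext (add_comm P.carrier Q.carrier)
  nsmul := nsmulRec

/-- Polytopes under Minkowski addition and dilation. -/
instance : Module ℝ≥0 (Polytope E) where
  one_smul P := Polytope.ext (by rw [carrier_smul, NNReal.coe_one, one_smul])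
  mul_smul r s P := Polytope.ext (by simp only [carrier_smul, NNReal.coe_mul, mul_smul])
  smul_zero r := Polytope.ext (by
    rw [carrier_smul, carrier_zero, Set.smul_set_singleton, smul_zero])
  smul_add r P Q := Polytope.ext (by simp only [carrier_smul, carrier_add, smul_add])
  add_smul r s P := Polytope.ext (by
    simp only [carrier_smul, carrier_add, NNReal.coe_add]
    exact P.convex.add_smul r.coe_nonneg s.coe_nonneg)
  zero_smul P := Polytope.ext (by
    rw [carrier_smul, carrier_zero, NNReal.coe_zero, Set.zero_smul_set P.nonempty,
      Set.singleton_zero])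

/-- The line segment `[a, b]`. -/
def seg (a b : E) : Polytope E :=
  ⟨segment ℝ a b, {a, b}, by simp, by simp, convexHull_pair a b⟩

theorem seg_comm (a b : E) : seg a b = seg b a := Polytope.ext (segment_symm ℝ a b)

/-- `Q` is a weak Minkowski summand, also called a deformation, of `P`. -/
def IsDeformation (P Q : Polytope E) : Prop :=
  ∃ (r : ℝ≥0) (R : Polytope E), Q + R = r • P

end Polytope

/-- Virtual polytopes: the Grothendieck group of polytopes under Minkowski addition. -/
def VirtualPolytope (E : Type*) [AddCommGroup E] [Module ℝ E] : Type _ :=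
  Algebra.GrothendieckAddGroup (Polytope E)

namespace VirtualPolytope

variable {E : Type*} [AddCommGroup E] [Module ℝ E]

instance : AddCommGroup (VirtualPolytope E) :=
  inferInstanceAs (AddCommGroup (Algebra.GrothendieckAddGroup (Polytope E)))

/-- A polytope `P`, seen as the virtual polytope `P - {0}`. -/
def of : Polytope E →+ VirtualPolytope E :=
  Algebra.GrothendieckAddGroup.of (M := Polytope E)

/-- The extension of an additive map on polytopes to virtual polytopes. -/
def lift {A : Type*} [AddCommGroup A] (f : Polytope E →+ A) : VirtualPolytope E →+ A :=
  Algebra.GrothendieckAddGroup.lift (M := Polytope E) f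

theorem lift_of {A : Type*} [AddCommGroup A] (f : Polytope E →+ A) (P : Polytope E) :
    lift f (of P) = f P :=
  DFunLike.congr_fun (Algebra.GrothendieckAddGroup.lift.symm_apply_apply f) P

theorem hom_ext {A : Type*} [AddCommGroup A] {f g : VirtualPolytope E →+ A}
    (h : ∀ P, f (of P) = g (of P)) : f = g :=
  Algebra.GrothendieckAddGroup.lift.symm.injective (AddMonoidHom.ext h)

/-- Dilation by a non-negative factor, extended additively to virtual polytopes. -/
def dilate (r : ℝ≥0) : VirtualPolytope E →+ VirtualPolytope E :=
  lift (of.comp (DistribSMul.toAddMonoidHom (Polytope E) r))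

theorem dilate_of (r : ℝ≥0) (P : Polytope E) : dilate r (of P) = of (r • P) :=
  lift_of _ P

theorem dilate_add (r s : ℝ≥0) (X : VirtualPolytope E) :
    dilate (r + s) X = dilate r X + dilate s X := by
  have : dilate (E := E) (r + s) = dilate r + dilate s :=
    hom_ext fun P => by
      rw [AddMonoidHom.add_apply, dilate_of, dilate_of, dilate_of, add_smul, map_add]
  rw [this, AddMonoidHom.add_apply]

theorem dilate_mul (r s : ℝ≥0) (X : VirtualPolytope E) :
    dilate (r * s) X = dilate r (dilate s X) := by
  have : dilate (E := E) (r * s) = (dilate r).comp (dilate s) :=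
    hom_ext fun P => by
      rw [AddMonoidHom.comp_apply, dilate_of, dilate_of, dilate_of, mul_smul]
  rw [this, AddMonoidHom.comp_apply]

theorem dilate_one (X : VirtualPolytope E) : dilate 1 X = X := by
  have : dilate (E := E) 1 = AddMonoidHom.id _ :=
    hom_ext fun P => by rw [dilate_of, one_smul, AddMonoidHom.id_apply]
  rw [this, AddMonoidHom.id_apply]

theorem dilate_zero (X : VirtualPolytope E) : dilate 0 X = 0 := by
  have h := dilate_add 0 0 X
  rw [add_zero] at h
  exact left_eq_add.mp h

/-- For `c ≥ 0`, multiplication by `c` is the dilation `c (P - Q) = cP - cQ`; for `c < 0`, it is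
`c (P - Q) = (-c)Q - (-c)P`. (One of the two dilation factors below is always `0`.) -/
instance : SMul ℝ (VirtualPolytope E) :=
  ⟨fun c X => dilate c.toNNReal X - dilate (-c).toNNReal X⟩

theorem smul_def (c : ℝ) (X : VirtualPolytope E) :
    c • X = dilate c.toNNReal X - dilate (-c).toNNReal X := rfl

theorem smul_eq_of_sub {c : ℝ} {r s : ℝ≥0} (h : c = r - s) (X : VirtualPolytope E) :
    c • X = dilate r X - dilate s X := by
  have key : c.toNNReal + s = r + (-c).toNNReal := by
    apply NNReal.eq
    push_cast
    rw [Real.coe_toNNReal', Real.coe_toNNReal']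
    rcases le_total c 0 with hc | hc
    · rw [max_eq_right hc, max_eq_left (by linarith)]; linarith
    · rw [max_eq_left hc, max_eq_right (by linarith)]; linarith
  rw [smul_def, sub_eq_sub_iff_add_eq_add, ← dilate_add, ← dilate_add, key]

theorem eq_toNNReal_sub (c : ℝ) : c = c.toNNReal - (-c).toNNReal := by
  rw [Real.coe_toNNReal', Real.coe_toNNReal']
  rcases le_total c 0 with hc | hc
  · rw [max_eq_right hc, max_eq_left (by linarith)]; linarith
  · rw [max_eq_left hc, max_eq_right (by linarith)]; linarith

/-- The real vector space of virtual polytopes. -/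
instance : Module ℝ (VirtualPolytope E) where
  one_smul X := by
    rw [smul_eq_of_sub (r := 1) (s := 0) (by simp), dilate_one, dilate_zero, sub_zero]
  mul_smul a b X := by
    rw [smul_eq_of_sub
      (r := a.toNNReal * b.toNNReal + (-a).toNNReal * (-b).toNNReal)
      (s := a.toNNReal * (-b).toNNReal + (-a).toNNReal * b.toNNReal)
      (by
        push_cast
        conv_lhs => rw [eq_toNNReal_sub a, eq_toNNReal_sub b]
        ring)]
    simp only [smul_def a, smul_def b, dilate_add, dilate_mul, map_sub]
    abel
  smul_zero a := by simp [smul_def]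
  smul_add a X Y := by
    simp only [smul_def, map_add]
    abel
  add_smul a b X := by
    rw [smul_eq_of_sub (r := a.toNNReal + b.toNNReal) (s := (-a).toNNReal + (-b).toNNReal)
      (by
        push_cast
        conv_lhs => rw [eq_toNNReal_sub a, eq_toNNReal_sub b]
        ring)]
    simp only [smul_def, dilate_add]
    abel
  zero_smul X := by simp [smul_def, dilate_zero]

end VirtualPolytope

/-- The space of virtual deformations of `P`: the linear span of the deformations of `P` in the
space of virtual polytopes. -/
def virtualDeformations {E : Type*} [AddCommGroup E] [Module ℝ E] (P : Polytope E) :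
    Submodule ℝ (VirtualPolytope E) :=
  Submodule.span ℝ (VirtualPolytope.of '' {Q | P.IsDeformation Q})

/-- The graphical zonotope of `G`: the Minkowski sum of the segments `[e_u, e_v]` over all edges
`uv` of `G`. -/
def graphicalZonotope {V : Type*} [Fintype V] [DecidableEq V] (G : SimpleGraph V) :
    Polytope (V → ℝ) :=
  ∑ e ∈ G.edgeSet.toFinite.toFinset,
    Sym2.lift ⟨fun u v => Polytope.seg (Pi.single u 1) (Pi.single v 1),
      fun _ _ => Polytope.seg_comm _ _⟩ e

/-- The permutahedron of `V` (up to translation): the graphical zonotope of the complete graph. -/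
def permutahedron (V : Type*) [Fintype V] [DecidableEq V] : Polytope (V → ℝ) :=
  graphicalZonotope (⊤ : SimpleGraph V)

/-- The face of the standard simplex with vertices `e_u`, for `u` in the non-empty set `U`. -/
def simplexFace {V : Type*} [DecidableEq V] (U : Finset V) (hU : U.Nonempty) :
    Polytope (V → ℝ) :=
  ⟨convexHull ℝ ((fun u : V => (Pi.single u 1 : V → ℝ)) '' U),
    _, U.finite_toSet.image _, hU.to_set.image _, rfl⟩

section Heights

variable {V : Type*} [Fintype V] [DecidableEq V]

/-- The linear form `x ↦ ∑_{v ∈ S} x_v - ∑_{v ∉ S} x_v`. -/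
def signedSum (S : Finset V) (x : V → ℝ) : ℝ :=
  ∑ v ∈ S, x v - ∑ v ∈ Sᶜ, x v

/-- The set `P_h` of points `x` with `∑_{v ∈ S} x_v - ∑_{v ∉ S} x_v ≤ h_S` for all `S ⊆ V`. -/
def heightSet (h : Finset V → ℝ) : Set (V → ℝ) :=
  {x | ∀ S, signedSum S x ≤ h S}

/-- `Q = P_h`, where the height vector `h` is tight: each of its inequalities is attained on `Q`. -/
def HasHeights (Q : Polytope (V → ℝ)) (h : Finset V → ℝ) : Prop :=
  Q.carrier = heightSet h ∧ ∀ S, IsGreatest (signedSum S '' Q.carrier) (h S)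

/-- The virtual polytope `X` is `P_h`: it is the difference `P_k - P_l` of two deformed
permutahedra with (tight) height vectors `k`, `l` such that `h = k - l`. -/
def IsVirtualOfHeights (h : Finset V → ℝ) (X : VirtualPolytope (V → ℝ)) : Prop :=
  ∃ (Q R : Polytope (V → ℝ)) (k l : Finset V → ℝ),
    (permutahedron V).IsDeformation Q ∧ (permutahedron V).IsDeformation R ∧
    HasHeights Q k ∧ HasHeights R l ∧ h = k - l ∧
    X = VirtualPolytope.of Q - VirtualPolytope.of R

/-- The coordinate form `h ↦ h_S` on `ℝ^{2^V}`. -/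
abbrev coordForm (S : Finset V) : Module.Dual ℝ (Finset V → ℝ) :=
  LinearMap.proj S

/-- The left hand sides of the equations, given for each non-clique `S` a pair `u_S`, `v_S` of
vertices: the equation `h_∅ + h_V = 0` is indexed by `none`, and the equation
`h_S + h_{S ∖ {u_S, v_S}} - h_{S ∖ {u_S}} - h_{S ∖ {v_S}} = 0` by `some S`. -/
def equationForm (G : SimpleGraph V) (u v : {S : Finset V // ¬ G.IsClique (S : Set V)} → V) :
    Option {S : Finset V // ¬ G.IsClique (S : Set V)} → Module.Dual ℝ (Finset V → ℝ)
  | none => coordForm ∅ + coordForm Finset.univ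
  | some S => coordForm S.1 + coordForm (S.1 \ {u S, v S})
      - coordForm (S.1 \ {u S}) - coordForm (S.1 \ {v S})

end Heights

end

/-!
For a set `S` of vertices, let `w_S` be the vector with entries `1` on `S` and `-1` off `S`, and
let the *height* of a polytope `P` at `S` be the maximum over `P` of the linear form `w_S`. Heights
are additive in `P`, hence extend to a linear map `heightMap` from virtual polytopes to
`Finset V → ℝ`. The whole statement follows from a comparison of three dimensions along this map.

*Upper bound.* The support function of `Z_G` is the sum over the edges `ab` of
`y ↦ max (y a) (y b)`, hence it is additive on any two vectors that do not order an edge strictly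
oppositely. Support functions being subadditive, each deformation of `Z_G` inherits this additivity
(`Polytope.IsDeformation.support_add_eq`). If `a, b ∈ S` are distinct and not adjacent, then both
`w_{S ∖ a}, w_{S ∖ b}` and `w_S, w_{S ∖ ab}` are such pairs, with the same sum, which is the
equation of `S` (`Polytope.IsDeformation.support_wall`); the pair `w_∅`, `w_V` gives the remaining
equation. For any choice of the missing edges these equations are linearly independent
(`linearIndependent_equationForm`), so the dimension of the solution space is the number of
non-empty cliques.

*Injectivity.* For the complete graph the additivity holds for all comonotone pairs. Since each
vector is a constant plus a non-negative combination of indicators of a chain of sets, a deformed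
permutahedron is cut out by its heights (`carrier_eq_heightSet`). Hence `heightMap` is injective on
the virtual deformations of the permutahedron, among which are those of `Z_G`
(`heightMap_injOn`), and `IsVirtualOfHeights h X` means that `X` is one of them, with image `h`.

*Lower bound.* For a clique `K`, the simplex `Δ_K` is a Minkowski summand of `Z_G`
(`isDeformation_simplexFace`): a vertex of `Z_G` is the sum of an end of each edge, and a summand
`e_t` coming from an edge `tw` inside `K` can be replaced by `e_w` without leaving `Z_G`. The
heights of the simplices `Δ_K` are linearly independent by Möbius inversion
(`linearIndependent_heights_simplexFace`), so they form a basis and `heightMap` maps the virtual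
deformations of `Z_G` onto the solution space (`exists_basis_virtualDeformations`).
-/

/-! ### Support functions of polytopes -/

namespace Polytope

section Sums

variable {E : Type*} [AddCommGroup E] [Module ℝ E]

theorem carrier_sum {ι : Type*} (s : Finset ι) (P : ι → Polytope E) :
    (∑ i ∈ s, P i).carrier = ∑ i ∈ s, (P i).carrier := by
  classical
  induction s using Finset.induction_on with
  | empty => rw [Finset.sum_empty, Finset.sum_empty, carrier_zero, Set.singleton_zero]
  | insert a s ha ih => rw [Finset.sum_insert ha, Finset.sum_insert ha, carrier_add, ih]

theorem IsDeformation.add {P Q Q' : Polytope E} (h : P.IsDeformation Q)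
    (h' : P.IsDeformation Q') : P.IsDeformation (Q + Q') := by
  obtain ⟨r, R, hR⟩ := h
  obtain ⟨r', R', hR'⟩ := h'
  exact ⟨r + r', R + R', by rw [add_add_add_comm, hR, hR', add_smul]⟩

theorem IsDeformation.smul {P Q : Polytope E} (c : ℝ≥0) (h : P.IsDeformation Q) :
    P.IsDeformation (c • Q) := by
  obtain ⟨r, R, hR⟩ := h
  exact ⟨c * r, c • R, by rw [← smul_add, hR, mul_smul]⟩

theorem isDeformation_zero (P : Polytope E) : P.IsDeformation 0 :=
  ⟨0, 0, by rw [add_zero, zero_smul]⟩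

theorem IsDeformation.add_right {P Q : Polytope E} (h : P.IsDeformation Q) (P' : Polytope E) :
    (P + P').IsDeformation Q := by
  obtain ⟨r, R, hR⟩ := h
  exact ⟨r, R + r • P', by rw [← add_assoc, hR, smul_add]⟩

end Sums

variable {V : Type*}

theorem isCompact (P : Polytope (V → ℝ)) : IsCompact P.carrier := by
  obtain ⟨s, hs, -, h⟩ := P.exists_finite'
  exact h ▸ hs.isCompact_convexHull ℝ

variable [Fintype V]

/-- The support function of `P`: the maximum over `P` of the linear form `x ↦ ∑ v, y v * x v`. -/
noncomputable def support (P : Polytope (V → ℝ)) (y : V → ℝ) : ℝ :=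
  sSup ((fun x => y ⬝ᵥ x) '' P.carrier)

theorem isGreatest_support (P : Polytope (V → ℝ)) (y : V → ℝ) :
    IsGreatest ((fun x => y ⬝ᵥ x) '' P.carrier) (P.support y) := by
  refine (P.isCompact.image ?_).isGreatest_sSup (P.nonempty.image _)
  unfold dotProduct
  fun_prop

theorem dotProduct_le_support {P : Polytope (V → ℝ)} {x : V → ℝ} (hx : x ∈ P.carrier)
    (y : V → ℝ) : y ⬝ᵥ x ≤ P.support y :=
  (P.isGreatest_support y).2 ⟨x, hx, rfl⟩

theorem exists_dotProduct_eq_support (P : Polytope (V → ℝ)) (y : V → ℝ) :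
    ∃ x ∈ P.carrier, y ⬝ᵥ x = P.support y :=
  (P.isGreatest_support y).1

theorem support_le {P : Polytope (V → ℝ)} {y : V → ℝ} {c : ℝ}
    (h : ∀ x ∈ P.carrier, y ⬝ᵥ x ≤ c) : P.support y ≤ c := by
  obtain ⟨x, hx, hxy⟩ := P.exists_dotProduct_eq_support y
  exact hxy ▸ h x hx

theorem support_add (P Q : Polytope (V → ℝ)) (y : V → ℝ) :
    (P + Q).support y = P.support y + Q.support y := by
  apply le_antisymm
  · refine support_le fun x hx => ?_
    obtain ⟨p, hp, q, hq, rfl⟩ := hx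
    rw [dotProduct_add]
    exact add_le_add (dotProduct_le_support hp y) (dotProduct_le_support hq y)
  · obtain ⟨p, hp, hpy⟩ := P.exists_dotProduct_eq_support y
    obtain ⟨q, hq, hqy⟩ := Q.exists_dotProduct_eq_support y
    rw [← hpy, ← hqy, ← dotProduct_add]
    exact dotProduct_le_support (Set.add_mem_add hp hq) y

theorem support_smul (r : ℝ≥0) (P : Polytope (V → ℝ)) (y : V → ℝ) :
    (r • P).support y = r * P.support y := by
  apply le_antisymm
  · refine support_le fun x hx => ?_
    obtain ⟨p, hp, rfl⟩ := hx
    simp only [dotProduct_smul, smul_eq_mul]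
    exact mul_le_mul_of_nonneg_left (dotProduct_le_support hp y) r.coe_nonneg
  · obtain ⟨p, hp, hpy⟩ := P.exists_dotProduct_eq_support y
    rw [← hpy, ← smul_eq_mul, ← dotProduct_smul]
    exact dotProduct_le_support (Set.smul_mem_smul_set hp) y

theorem support_sum {ι : Type*} (s : Finset ι) (P : ι → Polytope (V → ℝ)) (y : V → ℝ) :
    (∑ i ∈ s, P i).support y = ∑ i ∈ s, (P i).support y :=
  map_sum (AddMonoidHom.mk' (fun P : Polytope (V → ℝ) => P.support y)
    fun P Q => support_add P Q y) P s

theorem support_apply_zero (P : Polytope (V → ℝ)) : P.support 0 = 0 := by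
  obtain ⟨x, -, hx⟩ := P.exists_dotProduct_eq_support 0
  rw [← hx, zero_dotProduct]

theorem support_add_le (P : Polytope (V → ℝ)) (y z : V → ℝ) :
    P.support (y + z) ≤ P.support y + P.support z :=
  support_le fun x hx => by
    rw [add_dotProduct]
    exact add_le_add (dotProduct_le_support hx y) (dotProduct_le_support hx z)

theorem support_nonneg_smul (P : Polytope (V → ℝ)) {c : ℝ} (hc : 0 ≤ c) (y : V → ℝ) :
    P.support (c • y) = c * P.support y := by
  apply le_antisymm
  · refine support_le fun x hx => ?_
    rw [smul_dotProduct, smul_eq_mul]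
    exact mul_le_mul_of_nonneg_left (dotProduct_le_support hx y) hc
  · obtain ⟨x, hx, hxy⟩ := P.exists_dotProduct_eq_support y
    rw [← hxy, ← smul_eq_mul, ← smul_dotProduct]
    exact dotProduct_le_support hx _

/-- A polytope is the intersection of its supporting half-spaces. -/
theorem mem_carrier_of_dotProduct_le_support {P : Polytope (V → ℝ)} {x : V → ℝ}
    (h : ∀ y, y ⬝ᵥ x ≤ P.support y) : x ∈ P.carrier := by
  classical
  by_contra hx
  obtain ⟨f, c, hf, hc⟩ :=
    geometric_hahn_banach_closed_point P.convex P.isCompact.isClosed hx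
  have key : ∀ z : V → ℝ, (fun v => f (Pi.single v 1)) ⬝ᵥ z = f z := fun z => by
    conv_rhs => rw [pi_eq_sum_univ' z, map_sum]
    refine Finset.sum_congr rfl fun v _ => ?_
    rw [map_smul, smul_eq_mul, mul_comm]
  have h₁ := h fun v => f (Pi.single v 1)
  obtain ⟨p, hp, hpy⟩ := P.exists_dotProduct_eq_support fun v => f (Pi.single v 1)
  rw [← hpy, key, key] at h₁
  linarith [hf p hp]

theorem carrier_subset_of_support_le {P Q : Polytope (V → ℝ)}
    (h : ∀ y, P.support y ≤ Q.support y) : P.carrier ⊆ Q.carrier := fun _ hx =>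
  mem_carrier_of_dotProduct_le_support fun y => (dotProduct_le_support hx y).trans (h y)

/-- If the support function of `P` is additive on a pair of directions (that is, some point of `P`
is extremal in both), then so is that of each deformation of `P`, since support functions are
subadditive. -/
theorem IsDeformation.support_add_eq {P Q : Polytope (V → ℝ)} (hQ : P.IsDeformation Q)
    {y z : V → ℝ} (h : P.support (y + z) = P.support y + P.support z) :
    Q.support (y + z) = Q.support y + Q.support z := by
  obtain ⟨r, R, hR⟩ := hQ
  have key : ∀ w, Q.support w + R.support w = r * P.support w := fun w => by
    rw [← support_add, hR, support_smul]
  have h₁ := key (y + z)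
  rw [h, mul_add, ← key y, ← key z] at h₁
  linarith [Q.support_add_le y z, R.support_add_le y z]

theorem support_seg (a b y : V → ℝ) : (seg a b).support y = max (y ⬝ᵥ a) (y ⬝ᵥ b) := by
  apply le_antisymm
  · refine support_le fun x hx => ?_
    obtain ⟨s, t, hs, ht, hst, rfl⟩ := hx
    rw [dotProduct_add, dotProduct_smul, dotProduct_smul, smul_eq_mul, smul_eq_mul]
    calc s * y ⬝ᵥ a + t * y ⬝ᵥ b
        ≤ s * max (y ⬝ᵥ a) (y ⬝ᵥ b) + t * max (y ⬝ᵥ a) (y ⬝ᵥ b) := by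
          gcongr
          exacts [le_max_left _ _, le_max_right _ _]
      _ = max (y ⬝ᵥ a) (y ⬝ᵥ b) := by rw [← add_mul, hst, one_mul]
  · exact max_le (dotProduct_le_support (left_mem_segment ℝ a b) y)
      (dotProduct_le_support (right_mem_segment ℝ a b) y)

end Polytope

/-! ### Graphical zonotopes and their deformations -/

section Zonotope

open Polytope

variable {V : Type*} [DecidableEq V]

/-- The segment `[e_u, e_v]` attached to the unordered pair `uv`. -/
noncomputable def edgeSegment (e : Sym2 V) : Polytope (V → ℝ) :=
  Sym2.lift ⟨fun u v => seg (Pi.single u 1) (Pi.single v 1), fun _ _ => seg_comm _ _⟩ e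

theorem single_mem_edgeSegment {e : Sym2 V} {v : V} (hv : v ∈ e) :
    (Pi.single v 1 : V → ℝ) ∈ (edgeSegment e).carrier := by
  induction e using Sym2.ind with
  | _ a b =>
    rcases Sym2.mem_iff.mp hv with rfl | rfl
    · exact left_mem_segment ℝ _ _
    · exact right_mem_segment ℝ _ _

variable [Fintype V]

theorem graphicalZonotope_eq_sum (G : SimpleGraph V) :
    graphicalZonotope G = ∑ e ∈ G.edgeSet.toFinite.toFinset, edgeSegment e := rfl

theorem support_edgeSegment (a b : V) (y : V → ℝ) :
    (edgeSegment s(a, b)).support y = max (y a) (y b) := by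
  refine (support_seg _ _ y).trans ?_
  rw [dotProduct_single_one, dotProduct_single_one]

theorem edgeSegment_support_le {e : Sym2 V} {v : V} {y : V → ℝ}
    (h : ∀ w ∈ e, y w ≤ y v) : (edgeSegment e).support y ≤ y v := by
  induction e using Sym2.ind with
  | _ a b =>
    rw [support_edgeSegment]
    exact max_le (h a (Sym2.mem_mk_left a b)) (h b (Sym2.mem_mk_right a b))

/-- The vector `∑_{v ∈ S} e_v - ∑_{v ∉ S} e_v`, the normal vector of the form `signedSum S`. -/
def signVector (S : Finset V) : V → ℝ := fun v => if v ∈ S then 1 else -1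

theorem signVector_dotProduct (S : Finset V) (x : V → ℝ) :
    signVector S ⬝ᵥ x = signedSum S x := by
  rw [dotProduct, signedSum, ← Finset.sum_add_sum_compl S, sub_eq_add_neg,
    ← Finset.sum_neg_distrib]
  congr 1
  · exact Finset.sum_congr rfl fun v hv => by simp [signVector, hv]
  · exact Finset.sum_congr rfl fun v hv => by
      simp [signVector, Finset.mem_compl.mp hv]

theorem image_signedSum (S : Finset V) (P : Polytope (V → ℝ)) :
    signedSum S '' P.carrier = (fun x => signVector S ⬝ᵥ x) '' P.carrier :=
  Set.image_congr fun x _ => (signVector_dotProduct S x).symm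

/-- Two vectors are comonotone on the edges of `G` if no edge is ordered strictly oppositely by
them. -/
def ComonotoneOn (G : SimpleGraph V) (y z : V → ℝ) : Prop :=
  ∀ a b, G.Adj a b → y a < y b → z a ≤ z b

/-- A common maximizer on each edge makes the support function of `Z_G` additive. -/
theorem support_graphicalZonotope_add {G : SimpleGraph V} {y z : V → ℝ}
    (h : ComonotoneOn G y z) :
    (graphicalZonotope G).support (y + z) =
      (graphicalZonotope G).support y + (graphicalZonotope G).support z := by
  rw [graphicalZonotope_eq_sum, support_sum, support_sum, support_sum, ← Finset.sum_add_distrib]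
  refine Finset.sum_congr rfl fun e he => ?_
  induction e using Sym2.ind with
  | _ a b =>
    have hab : G.Adj a b := by simpa using he
    simp only [support_edgeSegment, Pi.add_apply]
    have h₁ := h a b hab
    have h₂ := h b a hab.symm
    rcases lt_trichotomy (y a) (y b) with hy | hy | hy
    · rw [max_eq_right (add_le_add hy.le (h₁ hy)), max_eq_right hy.le, max_eq_right (h₁ hy)]
    · rw [hy, max_self, max_add_add_left]
    · rw [max_eq_left (add_le_add hy.le (h₂ hy)), max_eq_left hy.le, max_eq_left (h₂ hy)]

theorem Polytope.IsDeformation.of_graphicalZonotope {G : SimpleGraph V} {Q : Polytope (V → ℝ)}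
    (hQ : (graphicalZonotope G).IsDeformation Q) : (permutahedron V).IsDeformation Q := by
  have hsub : G.edgeSet.toFinite.toFinset ⊆
      (⊤ : SimpleGraph V).edgeSet.toFinite.toFinset :=
    Set.Finite.toFinset_mono (SimpleGraph.edgeSet_mono le_top)
  have : permutahedron V = graphicalZonotope G +
      ∑ e ∈ (⊤ : SimpleGraph V).edgeSet.toFinite.toFinset \ G.edgeSet.toFinite.toFinset,
        edgeSegment e := by
    rw [add_comm]
    exact (Finset.sum_sdiff hsub).symm
  rw [this]
  exact hQ.add_right _

/-- A deformation of `Z_G` satisfies the wall equality of a pair of non-adjacent vertices `u`, `v`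
of `S`: both `w_{S ∖ u}, w_{S ∖ v}` and `w_S, w_{S ∖ uv}` are comonotone on the edges of `G`, and
they have the same sum. -/
theorem Polytope.IsDeformation.support_wall {G : SimpleGraph V} {Q : Polytope (V → ℝ)}
    (hQ : (graphicalZonotope G).IsDeformation Q) {S : Finset V} {u v : V} (hu : u ∈ S)
    (hv : v ∈ S) (huv : u ≠ v) (hadj : ¬ G.Adj u v) :
    Q.support (signVector (S \ {u})) + Q.support (signVector (S \ {v})) =
      Q.support (signVector S) + Q.support (signVector (S \ {u, v})) := by
  have hadj' : ¬ G.Adj v u := fun h => hadj h.symm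
  rw [← hQ.support_add_eq (support_graphicalZonotope_add (G := G) ?_),
    ← hQ.support_add_eq (support_graphicalZonotope_add (G := G) ?_)]
  · congr 1
    ext a
    by_cases ha : a ∈ S <;> by_cases hau : a = u <;> by_cases hav : a = v <;>
      simp_all [signVector]
  · intro a b hab h
    simp only [signVector, Finset.mem_sdiff, Finset.mem_insert, Finset.mem_singleton] at h ⊢
    split_ifs at h ⊢ <;> first | norm_num; done | (exfalso; norm_num at h; done) | (exfalso; tauto)
  · intro a b hab h
    have : ¬ (a = u ∧ b = v) := by rintro ⟨rfl, rfl⟩; exact hadj hab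
    have : ¬ (a = v ∧ b = u) := by rintro ⟨rfl, rfl⟩; exact hadj' hab
    simp only [signVector, Finset.mem_sdiff, Finset.mem_singleton] at h ⊢
    split_ifs at h ⊢ <;> first | norm_num; done | (exfalso; norm_num at h; done) | (exfalso; tauto)

theorem Polytope.IsDeformation.support_empty {G : SimpleGraph V} {Q : Polytope (V → ℝ)}
    (hQ : (graphicalZonotope G).IsDeformation Q) :
    Q.support (signVector ∅) = -Q.support (signVector Finset.univ) := by
  have h := hQ.support_add_eq (support_graphicalZonotope_add (G := G)
    (y := signVector ∅) (z := signVector Finset.univ) fun a b _ _ => by simp [signVector])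
  have h0 : (signVector ∅ + signVector Finset.univ : V → ℝ) = 0 := by
    ext a
    simp [signVector]
  rw [h0, support_apply_zero] at h
  linarith

/-- A non-negative vector is a non-negative combination of indicator vectors of a chain of sets,
so that the inequalities of a deformed permutahedron in these directions imply the one in its
direction. Each step subtracts the largest possible multiple of the indicator vector of the
support. -/
theorem dotProduct_le_support_of_nonneg {Q : Polytope (V → ℝ)}
    (hQ : (permutahedron V).IsDeformation Q) {x : V → ℝ}
    (hx : ∀ S : Finset V, (S : Set V).indicator 1 ⬝ᵥ x ≤ Q.support ((S : Set V).indicator 1))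
    (y : V → ℝ) (hy : 0 ≤ y) : y ⬝ᵥ x ≤ Q.support y := by
  induction hn : (Finset.univ.filter fun v => y v ≠ 0).card using Nat.strong_induction_on
    generalizing y with
  | _ n ih =>
  set S := Finset.univ.filter fun v => y v ≠ 0 with hS
  have hmem : ∀ v, v ∈ S ↔ y v ≠ 0 := fun v => by simp [hS]
  rcases S.eq_empty_or_nonempty with hS0 | hSne
  · have : y = 0 := by
      ext v
      by_contra hv
      have := (hmem v).mpr hv
      simp [hS0] at this
    rw [this, zero_dotProduct, support_apply_zero]
  obtain ⟨m, hm, hmin⟩ := S.exists_min_image y hSne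
  set i : V → ℝ := (S : Set V).indicator 1 with hi
  have hi1 : ∀ v ∈ S, i v = 1 := fun v hv => by simp [hi, hv]
  have hi0 : ∀ v, v ∉ S → i v = 0 := fun v hv => by simp [hi, hv]
  set z := y - y m • i with hz
  have hz1 : ∀ v ∈ S, z v = y v - y m := fun v hv => by simp [hz, hi1 v hv]
  have hz0 : ∀ v, v ∉ S → z v = 0 := fun v hv => by
    have : y v = 0 := by simpa using (hmem v).not.mp hv
    simp [hz, hi0 v hv, this]
  have hz_nonneg : 0 ≤ z := fun v => by
    by_cases hv : v ∈ S
    · rw [hz1 v hv]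
      exact sub_nonneg.mpr (hmin v hv)
    · exact (hz0 v hv).ge
  have hcard : (Finset.univ.filter fun v => z v ≠ 0).card < n := by
    rw [← hn]
    refine Finset.card_lt_card ⟨fun v hv => ?_, fun hsub => ?_⟩
    · by_contra hvS
      exact (Finset.mem_filter.mp hv).2 (hz0 v hvS)
    · exact (Finset.mem_filter.mp (hsub hm)).2 (by rw [hz1 m hm, sub_self])
  have hsum : y = z + y m • i := by rw [hz, sub_add_cancel]
  have hco : ComonotoneOn (⊤ : SimpleGraph V) z (y m • i) := fun a b _ hab => by
    have hb : b ∈ S := by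
      by_contra hb
      exact absurd (hz_nonneg a) (not_le.mpr (by simpa [hz0 b hb] using hab))
    simp only [Pi.smul_apply, smul_eq_mul, hi1 b hb]
    refine mul_le_mul_of_nonneg_left ?_ (hy m)
    by_cases ha : a ∈ S
    · exact (hi1 a ha).le
    · simp [hi0 a ha]
  rw [hsum, hQ.support_add_eq (support_graphicalZonotope_add hco), add_dotProduct,
    Q.support_nonneg_smul (hy m), smul_dotProduct, smul_eq_mul]
  exact add_le_add (ih _ hcard z hz_nonneg rfl) (mul_le_mul_of_nonneg_left (hx S) (hy m))

/-- The support function of a deformed permutahedron is linear on each cone of the braid fan,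
whose rays are spanned by the vectors `signVector S`: hence these directions suffice to
describe it. -/
theorem carrier_eq_heightSet {Q : Polytope (V → ℝ)} (hQ : (permutahedron V).IsDeformation Q) :
    Q.carrier = heightSet fun S => Q.support (signVector S) := by
  apply Set.Subset.antisymm
  · intro x hx S
    rw [← signVector_dotProduct]
    exact dotProduct_le_support hx _
  intro x hx
  have hx' : ∀ S, signVector S ⬝ᵥ x ≤ Q.support (signVector S) := fun S => by
    rw [signVector_dotProduct]
    exact hx S
  -- adding a constant vector is compatible with both sides
  have hadd : ∀ (c : ℝ) (y : V → ℝ), Q.support (y + fun _ => c) = Q.support y +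
      Q.support fun _ => c := fun c y =>
    hQ.support_add_eq (support_graphicalZonotope_add fun _ _ _ _ => le_rfl)
  have hconst : ∀ c : ℝ, 0 ≤ c → (fun _ => c) ⬝ᵥ x ≤ Q.support (fun _ => c) ∧
      (fun _ => -c) ⬝ᵥ x ≤ Q.support (fun _ => -c) := fun c hc => by
    have h₁ : (fun _ => c) = c • signVector (Finset.univ : Finset V) := by
      ext v; simp [signVector]
    have h₂ : (fun _ => -c) = c • signVector (∅ : Finset V) := by
      ext v; simp [signVector]
    rw [h₁, h₂, Q.support_nonneg_smul hc, Q.support_nonneg_smul hc, smul_dotProduct,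
      smul_dotProduct]
    exact ⟨mul_le_mul_of_nonneg_left (hx' _) hc, mul_le_mul_of_nonneg_left (hx' _) hc⟩
  have hind : ∀ S : Finset V,
      (S : Set V).indicator 1 ⬝ᵥ x ≤ Q.support ((S : Set V).indicator 1) := fun S => by
    have h : (S : Set V).indicator 1 = (2⁻¹ : ℝ) • signVector S + fun _ => (2⁻¹ : ℝ) := by
      ext v
      by_cases hv : v ∈ S <;> simp [signVector, hv]
      norm_num
    rw [h, hadd, add_dotProduct, Q.support_nonneg_smul (by norm_num), smul_dotProduct]
    exact add_le_add (mul_le_mul_of_nonneg_left (hx' S) (by norm_num))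
      (hconst _ (by norm_num)).1
  refine mem_carrier_of_dotProduct_le_support fun y => ?_
  set c : ℝ := ∑ v, |y v| with hc
  have hc0 : 0 ≤ c := Finset.sum_nonneg fun _ _ => abs_nonneg _
  have hy : y = (y + fun _ => c) + fun _ => -c := by
    ext v
    simp
  rw [hy, hadd, add_dotProduct]
  refine add_le_add (dotProduct_le_support_of_nonneg hQ hind _ fun v => ?_) (hconst c hc0).2
  have := Finset.single_le_sum (f := fun v => |y v|) (fun _ _ => abs_nonneg _)
    (Finset.mem_univ v)
  simp only [Pi.zero_apply, Pi.add_apply]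
  linarith [neg_abs_le (y v)]

theorem hasHeights_support {Q : Polytope (V → ℝ)} (hQ : (permutahedron V).IsDeformation Q) :
    HasHeights Q fun S => Q.support (signVector S) :=
  ⟨carrier_eq_heightSet hQ, fun S => by
    rw [image_signedSum]
    exact Q.isGreatest_support _⟩

theorem HasHeights.eq_support {Q : Polytope (V → ℝ)} {k : Finset V → ℝ} (h : HasHeights Q k) :
    k = fun S => Q.support (signVector S) :=
  funext fun S => (h.2 S).unique (by rw [image_signedSum]; exact Q.isGreatest_support _)

end Zonotope

/-! ### Clique faces of the simplex are deformations of the graphical zonotope -/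

section Simplex

open Polytope

variable {V : Type*} [DecidableEq V]

theorem single_mem_simplexFace {U : Finset V} (hU : U.Nonempty) {v : V} (hv : v ∈ U) :
    (Pi.single v 1 : V → ℝ) ∈ (simplexFace U hU).carrier :=
  subset_convexHull ℝ _ ⟨v, hv, rfl⟩

/-- For each direction `y`, each pair of vertices has a `y`-maximal element, and ties can be broken
in favour of some `t ∈ K` in all the pairs of elements of `K` that contain `t`. -/
theorem exists_maximal_choice {K : Finset V} (hK : K.Nonempty) (y : V → ℝ) :
    ∃ t ∈ K, ∃ c : Sym2 V → V, (∀ e, c e ∈ e ∧ ∀ w ∈ e, y w ≤ y (c e)) ∧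
      ∀ w ∈ K, w ≠ t → c s(t, w) = t := by
  classical
  obtain ⟨t, ht, hmax⟩ := K.exists_max_image y hK
  have h : ∀ e : Sym2 V, ∃ v ∈ e, ∀ w ∈ e, y w ≤ y v := fun e => by
    induction e using Sym2.ind with
    | _ a b =>
      rcases le_total (y a) (y b) with h | h
      · exact ⟨b, by simp, by simp [h]⟩
      · exact ⟨a, by simp, by simp [h]⟩
  choose c hc hcmax using h
  refine ⟨t, ht, fun e => if ∃ w ∈ K, e = s(t, w) then t else c e, fun e => ?_, fun w hw _ => ?_⟩
  · dsimp only
    split_ifs with he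
    · obtain ⟨w, hw, rfl⟩ := he
      exact ⟨Sym2.mem_mk_left t w, by simp [hmax w hw]⟩
    · exact ⟨hc e, hcmax e⟩
  · exact if_pos ⟨w, hw, rfl⟩

variable [Fintype V]

theorem support_simplexFace_le {U : Finset V} (hU : U.Nonempty) {y : V → ℝ} {c : ℝ}
    (h : ∀ v ∈ U, y v ≤ c) : (simplexFace U hU).support y ≤ c := by
  refine support_le fun x hx => ?_
  have hlin : IsLinearMap ℝ fun z : V → ℝ => y ⬝ᵥ z :=
    ⟨dotProduct_add y, fun r z => dotProduct_smul r y z⟩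
  refine convexHull_min (t := {z | y ⬝ᵥ z ≤ c}) ?_ (convex_halfSpace_le hlin c) hx
  rintro _ ⟨v, hv, rfl⟩
  simpa using h v hv

theorem support_simplexFace {U : Finset V} (hU : U.Nonempty) (S : Finset V) :
    (simplexFace U hU).support (signVector S) = if Disjoint U S then -1 else 1 := by
  apply le_antisymm
  · refine support_simplexFace_le hU fun v hv => ?_
    split_ifs with h
    · simp [signVector, Finset.disjoint_left.mp h hv]
    · unfold signVector
      split_ifs <;> norm_num
  · split_ifs with h
    · obtain ⟨v, hv⟩ := hU
      have := dotProduct_le_support (single_mem_simplexFace ⟨v, hv⟩ hv) (signVector S)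
      simpa [signVector, Finset.disjoint_left.mp h hv] using this
    · obtain ⟨v, hv, hvS⟩ := Finset.not_disjoint_iff.mp h
      have := dotProduct_le_support (single_mem_simplexFace hU hv) (signVector S)
      simpa [signVector, hvS] using this

/-- The candidate vertices of the polytope `R` such that `Δ_K + R = Z_G`, for a clique `K`: an
end `c e` of each edge is chosen such that some vertex `t` of `K` is chosen in all its edges to
other vertices of `K`, and one copy of `e_t` is removed from the sum of the `e_{c e}`. -/
def complementVertices (G : SimpleGraph V) (K : Finset V) : Set (V → ℝ) :=
  {x | ∃ t ∈ K, ∃ c : Sym2 V → V, (∀ e ∈ G.edgeSet.toFinite.toFinset, c e ∈ e) ∧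
    (∀ w ∈ K, w ≠ t → c s(t, w) = t) ∧
    x = ∑ e ∈ G.edgeSet.toFinite.toFinset, Pi.single (c e) 1 - Pi.single t 1}

theorem finite_complementVertices (G : SimpleGraph V) (K : Finset V) :
    (complementVertices G K).Finite := by
  refine (Set.finite_range fun p : V × (Sym2 V → V) =>
    (∑ e ∈ G.edgeSet.toFinite.toFinset, Pi.single (p.2 e) 1 - Pi.single p.1 1 :
      V → ℝ)).subset ?_
  rintro x ⟨t, -, c, -, -, rfl⟩
  exact ⟨(t, c), rfl⟩

theorem complementVertices_nonempty (G : SimpleGraph V) {K : Finset V} (hK : K.Nonempty) :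
    (complementVertices G K).Nonempty := by
  obtain ⟨t, ht, c, hc, hct⟩ := exists_maximal_choice hK 0
  exact ⟨_, t, ht, c, fun e _ => (hc e).1, hct, rfl⟩

theorem sum_single_mem_graphicalZonotope {G : SimpleGraph V} {c : Sym2 V → V}
    (hc : ∀ e ∈ G.edgeSet.toFinite.toFinset, c e ∈ e) :
    (∑ e ∈ G.edgeSet.toFinite.toFinset, Pi.single (c e) 1 : V → ℝ) ∈
      (graphicalZonotope G).carrier := by
  rw [graphicalZonotope_eq_sum, carrier_sum]
  exact Set.finsetSum_mem_finsetSum _ _ _ fun e he => single_mem_edgeSegment (hc e he)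

/-- For a clique `K`, the simplex face `Δ_K` is a Minkowski summand of `Z_G`, with complement the
convex hull of `complementVertices G K`. Adding `e_w` to a candidate vertex with distinguished
vertex `t` amounts to choosing `w` rather than `t` in the edge `tw`, which gives a point of `Z_G`;
conversely, each direction is maximized on `Z_G` by the sum of `e_t` and a candidate vertex. -/
theorem isDeformation_simplexFace {G : SimpleGraph V} {K : Finset V} (hK : K.Nonempty)
    (hG : G.IsClique (K : Set V)) : (graphicalZonotope G).IsDeformation (simplexFace K hK) := by
  let R : Polytope (V → ℝ) := ⟨convexHull ℝ (complementVertices G K), _,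
    finite_complementVertices G K, complementVertices_nonempty G hK, rfl⟩
  refine ⟨1, R, ?_⟩
  rw [one_smul]
  refine Polytope.ext (Set.Subset.antisymm ?_ (carrier_subset_of_support_le fun y => ?_))
  · change convexHull ℝ ((fun w : V => (Pi.single w 1 : V → ℝ)) '' (K : Set V)) +
      convexHull ℝ (complementVertices G K) ⊆ (graphicalZonotope G).carrier
    rw [← convexHull_add]
    refine convexHull_min ?_ (graphicalZonotope G).convex
    rintro _ ⟨_, ⟨w, hw, rfl⟩, _, ⟨t, ht, c, hc, hct, rfl⟩, rfl⟩
    dsimp only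
    rcases eq_or_ne w t with rfl | hwt
    · rw [add_sub_cancel]
      exact sum_single_mem_graphicalZonotope hc
    have he : s(t, w) ∈ G.edgeSet.toFinite.toFinset := by
      simpa using hG ht hw hwt.symm
    have hc' : ∀ e ∈ G.edgeSet.toFinite.toFinset, Function.update c s(t, w) w e ∈ e := by
      intro e he'
      rcases eq_or_ne e s(t, w) with rfl | hne
      · simp
      · rw [Function.update_of_ne hne]
        exact hc e he'
    have h := sum_single_mem_graphicalZonotope hc'
    rw [← Finset.add_sum_erase _ _ he, Function.update_self] at h
    rw [← Finset.add_sum_erase _ _ he, hct w hw hwt]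
    convert h using 1
    rw [add_sub_cancel_left]
    congr 1
    refine Finset.sum_congr rfl fun e he' => ?_
    rw [Function.update_of_ne (Finset.ne_of_mem_erase he')]
  · obtain ⟨t, ht, c, hc, hct⟩ := exists_maximal_choice hK y
    have hmem : (Pi.single t 1 : V → ℝ) +
        (∑ e ∈ G.edgeSet.toFinite.toFinset, Pi.single (c e) 1 - Pi.single t 1) ∈
        (simplexFace K hK + R).carrier :=
      Set.add_mem_add (single_mem_simplexFace hK ht)
        (subset_convexHull ℝ _ ⟨t, ht, c, fun e _ => (hc e).1, hct, rfl⟩)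
    rw [add_sub_cancel] at hmem
    refine le_trans ?_ (dotProduct_le_support hmem y)
    rw [graphicalZonotope_eq_sum, support_sum, dotProduct_sum]
    refine Finset.sum_le_sum fun e _ => ?_
    rw [dotProduct_single_one]
    exact edgeSegment_support_le (hc e).2

end Simplex

/-! ### Virtual deformations as differences -/

section Differences

open Polytope

variable {E : Type*} [AddCommGroup E] [Module ℝ E]

theorem smul_of_eq (c : ℝ) (P : Polytope E) :
    c • VirtualPolytope.of P =
      VirtualPolytope.of (c.toNNReal • P) - VirtualPolytope.of ((-c).toNNReal • P) := by
  rw [VirtualPolytope.smul_def, VirtualPolytope.dilate_of, VirtualPolytope.dilate_of]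

/-- Since deformations are stable under sums and dilations, each virtual deformation is a
difference of two deformations. -/
theorem exists_sub_of_mem_virtualDeformations {P : Polytope E}
    {X : VirtualPolytope E} (hX : X ∈ virtualDeformations P) :
    ∃ Q R, P.IsDeformation Q ∧ P.IsDeformation R ∧
      X = VirtualPolytope.of Q - VirtualPolytope.of R := by
  induction hX using Submodule.span_induction with
  | mem X hX =>
    obtain ⟨Q, hQ, rfl⟩ := hX
    exact ⟨Q, 0, hQ, isDeformation_zero P, by rw [map_zero, sub_zero]⟩
  | zero => exact ⟨0, 0, isDeformation_zero P, isDeformation_zero P, by rw [sub_self]⟩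
  | add X Y _ _ hX hY =>
    obtain ⟨Q, R, hQ, hR, rfl⟩ := hX
    obtain ⟨Q', R', hQ', hR', rfl⟩ := hY
    exact ⟨Q + Q', R + R', hQ.add hQ', hR.add hR', by rw [map_add, map_add]; abel⟩
  | smul c X _ hX =>
    obtain ⟨Q, R, hQ, hR, rfl⟩ := hX
    refine ⟨c.toNNReal • Q + (-c).toNNReal • R, c.toNNReal • R + (-c).toNNReal • Q,
      (hQ.smul _).add (hR.smul _), (hR.smul _).add (hQ.smul _), ?_⟩
    rw [smul_sub, smul_of_eq, smul_of_eq, map_add, map_add]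
    abel

theorem of_mem_virtualDeformations {P Q : Polytope E} (hQ : P.IsDeformation Q) :
    VirtualPolytope.of Q ∈ virtualDeformations P :=
  Submodule.subset_span ⟨Q, hQ, rfl⟩

end Differences

/-! ### Heights of virtual polytopes -/

section Heights

open Polytope

variable {V : Type*} [Fintype V] [DecidableEq V]

/-- The linear map sending a virtual polytope `P - Q` to the difference of the heights of `P` and
`Q`, that is, of the maxima of the forms `signedSum S`. -/
noncomputable def heightMap (V : Type*) [Fintype V] [DecidableEq V] :
    VirtualPolytope (V → ℝ) →ₗ[ℝ] (Finset V → ℝ) :=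
  let f : VirtualPolytope (V → ℝ) →+ (Finset V → ℝ) :=
    VirtualPolytope.lift (AddMonoidHom.mk' (fun P S => P.support (signVector S))
      fun P Q => funext fun S => support_add P Q _)
  { f with
    map_smul' := fun c X => by
      have h : ∀ (r : ℝ≥0) (X : VirtualPolytope (V → ℝ)),
          f (VirtualPolytope.dilate r X) = (r : ℝ) • f X := fun r X => by
        have : f.comp (VirtualPolytope.dilate r) =
            (DistribSMul.toAddMonoidHom (Finset V → ℝ) (r : ℝ)).comp f := by
          refine VirtualPolytope.hom_ext fun P => ?_
          simp only [AddMonoidHom.comp_apply, VirtualPolytope.dilate_of]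
          ext S
          simp [f, VirtualPolytope.lift_of, support_smul]
        exact DFunLike.congr_fun this X
      change f (c • X) = c • f X
      rw [VirtualPolytope.smul_def, map_sub, h, h, ← sub_smul,
        ← VirtualPolytope.eq_toNNReal_sub] }

theorem heightMap_of (P : Polytope (V → ℝ)) :
    heightMap V (VirtualPolytope.of P) = fun S => P.support (signVector S) :=
  VirtualPolytope.lift_of _ P

theorem virtualDeformations_le_permutahedron (G : SimpleGraph V) :
    virtualDeformations (graphicalZonotope G) ≤ virtualDeformations (permutahedron V) :=
  Submodule.span_mono (Set.image_mono fun _ hQ => hQ.of_graphicalZonotope)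

/-- Virtual deformed permutahedra are determined by their heights. -/
theorem heightMap_injOn :
    Set.InjOn (heightMap V) (virtualDeformations (permutahedron V)) := by
  intro X hX Y hY h
  rw [← sub_eq_zero]
  obtain ⟨Q, R, hQ, hR, hXY⟩ :=
    exists_sub_of_mem_virtualDeformations (Submodule.sub_mem _ hX hY)
  have h' : heightMap V (X - Y) = 0 := by rw [map_sub, h, sub_self]
  rw [hXY, map_sub, sub_eq_zero, heightMap_of, heightMap_of] at h'
  have : Q = R := Polytope.ext (by rw [carrier_eq_heightSet hQ, carrier_eq_heightSet hR, h'])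
  rw [hXY, this, sub_self]

theorem isVirtualOfHeights_heightMap {X : VirtualPolytope (V → ℝ)}
    (hX : X ∈ virtualDeformations (permutahedron V)) :
    IsVirtualOfHeights (heightMap V X) X := by
  obtain ⟨Q, R, hQ, hR, rfl⟩ := exists_sub_of_mem_virtualDeformations hX
  exact ⟨Q, R, _, _, hQ, hR, hasHeights_support hQ, hasHeights_support hR,
    by rw [map_sub, heightMap_of, heightMap_of], rfl⟩

theorem IsVirtualOfHeights.mem {h : Finset V → ℝ} {X : VirtualPolytope (V → ℝ)}
    (hX : IsVirtualOfHeights h X) : X ∈ virtualDeformations (permutahedron V) := by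
  obtain ⟨Q, R, _, _, hQ, hR, -, -, -, rfl⟩ := hX
  exact Submodule.sub_mem _ (of_mem_virtualDeformations hQ) (of_mem_virtualDeformations hR)

theorem IsVirtualOfHeights.heightMap_eq {h : Finset V → ℝ} {X : VirtualPolytope (V → ℝ)}
    (hX : IsVirtualOfHeights h X) : heightMap V X = h := by
  obtain ⟨Q, R, k, l, -, -, hk, hl, rfl, rfl⟩ := hX
  rw [map_sub, heightMap_of, heightMap_of, hk.eq_support, hl.eq_support]

theorem IsVirtualOfHeights.unique {h : Finset V → ℝ} {X Y : VirtualPolytope (V → ℝ)}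
    (hX : IsVirtualOfHeights h X) (hY : IsVirtualOfHeights h Y) : X = Y :=
  heightMap_injOn hX.mem hY.mem (hX.heightMap_eq.trans hY.heightMap_eq.symm)

/-- The heights of the faces of the standard simplex are linearly independent, by Möbius inversion:
up to an affine change of values, they are the indicator functions of `{S | U ⊆ Sᶜ}`. -/
theorem linearIndependent_heights_simplexFace (p : Finset V → Prop) (hp : ∀ U, p U → U.Nonempty) :
    LinearIndependent ℝ fun U : {U : Finset V // p U} =>
      heightMap V (VirtualPolytope.of (simplexFace U.1 (hp U.1 U.2))) := by
  classical
  rw [Fintype.linearIndependent_iff]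
  intro g hg
  have hval : ∀ S : Finset V, ∑ U : {U : Finset V // p U},
      g U * (if Disjoint U.1 S then -1 else 1) = 0 := fun S => by
    have := congrFun hg S
    simpa [heightMap_of, support_simplexFace] using this
  have htot : ∑ U, g U = 0 := by
    rw [← hval Finset.univ]
    refine Finset.sum_congr rfl fun U _ => ?_
    rw [if_neg, mul_one]
    obtain ⟨v, hv⟩ := hp U.1 U.2
    exact Finset.not_disjoint_iff.mpr ⟨v, hv, Finset.mem_univ v⟩
  have hsub : ∀ T : Finset V, ∑ U : {U : Finset V // p U},
      (if U.1 ⊆ T then g U else 0) = 0 := fun T => by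
    have h : ∑ U : {U : Finset V // p U}, (if U.1 ⊆ T then g U else 0) =
        (∑ U, g U - ∑ U : {U : Finset V // p U},
          g U * (if Disjoint U.1 Tᶜ then -1 else 1)) / 2 := by
      rw [← Finset.sum_sub_distrib, Finset.sum_div]
      refine Finset.sum_congr rfl fun U _ => ?_
      by_cases hU : U.1 ⊆ T
      · rw [if_pos hU, if_pos (disjoint_compl_right_iff.mpr hU)]
        ring
      · rw [if_neg hU, if_neg (disjoint_compl_right_iff.not.mpr hU)]
        ring
    rw [h, htot, hval, sub_zero, zero_div]
  by_contra! hne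
  obtain ⟨U₀, hU₀⟩ := hne
  -- a set of minimal size among those with a non-zero coefficient
  obtain ⟨U, hU, hmin⟩ := (Finset.univ.filter fun U => g U ≠ 0).exists_min_image
    (fun U => U.1.card) ⟨U₀, by simpa using hU₀⟩
  have h := hsub U.1
  rw [Finset.sum_eq_single U _ (by simp), if_pos subset_rfl] at h
  · exact (Finset.mem_filter.mp hU).2 h
  · intro W _ hWU
    by_contra hW
    have hsub' : W.1 ⊆ U.1 := by
      by_contra h'
      exact hW (if_neg h')
    rw [if_pos hsub'] at hW
    exact hWU (Subtype.ext (Finset.eq_of_subset_of_card_le hsub'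
      (hmin W (Finset.mem_filter.mpr ⟨Finset.mem_univ W, hW⟩))))

end Heights

/-! ### The linear equations -/

section Equations

open Polytope

theorem exists_nonadjacent_of_not_isClique {V : Type*} {G : SimpleGraph V}
    (S : {S : Finset V // ¬ G.IsClique (S : Set V)}) :
    ∃ a b, a ∈ S.1 ∧ b ∈ S.1 ∧ a ≠ b ∧ ¬ G.Adj a b := by
  have h := S.2
  simp only [SimpleGraph.isClique_iff, Set.Pairwise] at h
  push Not at h
  obtain ⟨a, ha, b, hb, hab, hadj⟩ := h
  exact ⟨a, b, ha, hb, hab, hadj⟩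

variable {V : Type*} [Fintype V] [DecidableEq V] {G : SimpleGraph V}
  {u v : {S : Finset V // ¬ G.IsClique (S : Set V)} → V}

theorem equationForm_none_apply (h : Finset V → ℝ) :
    equationForm G u v none h = h ∅ + h Finset.univ := rfl

theorem equationForm_some_apply (S : {S : Finset V // ¬ G.IsClique (S : Set V)})
    (h : Finset V → ℝ) :
    equationForm G u v (some S) h =
      h S.1 + h (S.1 \ {u S, v S}) - h (S.1 \ {u S}) - h (S.1 \ {v S}) := rfl

/-- The constant vector `1` isolates the equation `none`, and the remaining equations are
triangular with respect to the size of `S`. -/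
theorem linearIndependent_equationForm (hu : ∀ S, u S ∈ S.1) (hv : ∀ S, v S ∈ S.1) :
    LinearIndependent ℝ (equationForm G u v) := by
  classical
  rw [Fintype.linearIndependent_iff]
  intro g hg
  have hval : ∀ h : Finset V → ℝ, g none * equationForm G u v none h +
      ∑ S, g (some S) * equationForm G u v (some S) h = 0 := fun h => by
    have := LinearMap.congr_fun hg h
    simpa only [Fintype.sum_option, LinearMap.add_apply, LinearMap.smul_apply,
      LinearMap.sum_apply, smul_eq_mul, LinearMap.zero_apply] using this
  have hnone : g none = 0 := by
    have := hval fun _ => 1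
    simp only [equationForm_none_apply, equationForm_some_apply] at this
    norm_num at this
    exact this
  have hsome : ∀ S, g (some S) = 0 := by
    by_contra! hne
    obtain ⟨S₀, hS₀⟩ := hne
    -- a set of maximal size among those with a non-zero coefficient
    obtain ⟨T, hT, hmax⟩ := (Finset.univ.filter fun S => g (some S) ≠ 0).exists_max_image
      (fun S => S.1.card) ⟨S₀, by simpa using hS₀⟩
    have hdel : ∀ S, g (some S) ≠ 0 → ∀ A : Finset V, (∃ a ∈ A, a ∈ S.1) →
        (Pi.single T.1 1 : Finset V → ℝ) (S.1 \ A) = 0 := fun S hS A ⟨a, haA, haS⟩ => by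
      refine Pi.single_eq_of_ne (fun h => ?_) _
      have h₁ : (S.1 \ A).card < S.1.card :=
        Finset.card_lt_card ⟨Finset.sdiff_subset, fun h' =>
          (Finset.mem_sdiff.mp (h' haS)).2 haA⟩
      have h₂ := hmax S (Finset.mem_filter.mpr ⟨Finset.mem_univ S, hS⟩)
      rw [h] at h₁
      exact absurd h₁ (not_lt.mpr h₂)
    have hform : ∀ S, g (some S) ≠ 0 → equationForm G u v (some S) (Pi.single T.1 1) =
        (Pi.single T.1 1 : Finset V → ℝ) S.1 := fun S hS => by
      rw [equationForm_some_apply, hdel S hS _ ⟨u S, by simp, hu S⟩,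
        hdel S hS _ ⟨u S, by simp, hu S⟩, hdel S hS _ ⟨v S, by simp, hv S⟩]
      ring
    have h := hval (Pi.single T.1 1)
    have hT' := (Finset.mem_filter.mp hT).2
    rw [hnone, zero_mul, zero_add, Finset.sum_eq_single T _ (by simp), hform T hT',
      Pi.single_eq_same, mul_one] at h
    · exact hT' h
    · intro S _ hST
      by_cases hS : g (some S) = 0
      · rw [hS, zero_mul]
      · rw [hform S hS, Pi.single_eq_of_ne fun h => hST (Subtype.ext h), mul_zero]
  rintro (_ | S)
  exacts [hnone, hsome S]

variable (G u v) in
/-- The space of the solutions of all the equations `equationForm G u v i h = 0`. -/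
noncomputable def solutionSpace : Submodule ℝ (Finset V → ℝ) :=
  (Submodule.span ℝ (Set.range (equationForm G u v))).dualCoannihilator

theorem mem_solutionSpace {h : Finset V → ℝ} :
    h ∈ solutionSpace G u v ↔ h ∅ = -h Finset.univ ∧
      ∀ S : {S : Finset V // ¬ G.IsClique (S : Set V)},
        h (S.1 \ {u S}) + h (S.1 \ {v S}) = h S.1 + h (S.1 \ {u S, v S}) := by
  have h₁ : h ∈ solutionSpace G u v ↔ ∀ i, equationForm G u v i h = 0 := by
    rw [solutionSpace, ← SetLike.mem_coe, Submodule.coe_dualCoannihilator_span]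
    exact Set.forall_mem_range
  rw [h₁, Option.forall, equationForm_none_apply, eq_neg_iff_add_eq_zero]
  refine and_congr_right fun _ => forall_congr' fun S => ?_
  rw [equationForm_some_apply, sub_sub, sub_eq_zero, eq_comm]

theorem finrank_solutionSpace (hu : ∀ S, u S ∈ S.1) (hv : ∀ S, v S ∈ S.1) :
    Module.finrank ℝ (solutionSpace G u v) =
      Nat.card {K : Finset V // K.Nonempty ∧ G.IsClique (K : Set V)} := by
  classical
  have h := Subspace.finrank_add_finrank_dualCoannihilator_eq
    (Submodule.span ℝ (Set.range (equationForm G u v)))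
  rw [finrank_span_eq_card (linearIndependent_equationForm hu hv), Module.finrank_pi,
    Fintype.card_option] at h
  have hcompl := Fintype.card_subtype_compl fun S : Finset V => G.IsClique (S : Set V)
  have hle := Fintype.card_subtype_le fun S : Finset V => G.IsClique (S : Set V)
  have hcl : Fintype.card {K : Finset V // K.Nonempty ∧ G.IsClique (K : Set V)} + 1 =
      Fintype.card {S : Finset V // G.IsClique (S : Set V)} := by
    rw [Fintype.card_subtype, Fintype.card_subtype,
      ← Finset.card_insert_of_notMem (a := (∅ : Finset V)) (by simp)]
    congr 1
    ext S
    rcases S.eq_empty_or_nonempty with rfl | hS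
    · simp
    · simp [hS, hS.ne_empty]
  rw [Nat.card_eq_fintype_card]
  change _ + Module.finrank ℝ (solutionSpace G u v) = _ at h
  omega

theorem heightMap_mem_solutionSpace
    (huv : ∀ S, u S ∈ S.1 ∧ v S ∈ S.1 ∧ u S ≠ v S ∧ ¬ G.Adj (u S) (v S))
    {X : VirtualPolytope (V → ℝ)} (hX : X ∈ virtualDeformations (graphicalZonotope G)) :
    heightMap V X ∈ solutionSpace G u v := by
  suffices virtualDeformations (graphicalZonotope G) ≤
    (solutionSpace G u v).comap (heightMap V) from this hX
  refine Submodule.span_le.mpr ?_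
  rintro _ ⟨Q, hQ, rfl⟩
  rw [SetLike.mem_coe, Submodule.mem_comap, heightMap_of, mem_solutionSpace]
  exact ⟨hQ.support_empty, fun S =>
    hQ.support_wall (huv S).1 (huv S).2.1 (huv S).2.2.1 (huv S).2.2.2⟩

/-- The virtual deformations of `Z_G` contain the simplex faces of the cliques, whose heights are
linearly independent, and embed into the solution space, whose dimension is the number of these
faces. -/
theorem exists_basis_virtualDeformations
    (huv : ∀ S, u S ∈ S.1 ∧ v S ∈ S.1 ∧ u S ≠ v S ∧ ¬ G.Adj (u S) (v S)) :
    (∃ b : Module.Basis {K : Finset V // K.Nonempty ∧ G.IsClique (K : Set V)} ℝ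
        (virtualDeformations (graphicalZonotope G)),
      ∀ K, (b K : VirtualPolytope (V → ℝ)) = VirtualPolytope.of (simplexFace K.1 K.2.1)) ∧
    (virtualDeformations (graphicalZonotope G)).map (heightMap V) = solutionSpace G u v := by
  classical
  set D := virtualDeformations (graphicalZonotope G)
  have hinj : Function.Injective ((heightMap V).domRestrict D) := fun X Y h =>
    Subtype.ext (heightMap_injOn (virtualDeformations_le_permutahedron G X.2)
      (virtualDeformations_le_permutahedron G Y.2) h)
  have : FiniteDimensional ℝ D := Module.Finite.of_injective _ hinj
  let b : {K : Finset V // K.Nonempty ∧ G.IsClique (K : Set V)} → D := fun K =>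
    ⟨_, of_mem_virtualDeformations (isDeformation_simplexFace K.2.1 K.2.2)⟩
  have hb : LinearIndependent ℝ b := LinearIndependent.of_comp ((heightMap V).domRestrict D)
    (linearIndependent_heights_simplexFace _ fun _ h => h.1)
  have hle : D.map (heightMap V) ≤ solutionSpace G u v :=
    Submodule.map_le_iff_le_comap.mpr fun X hX => heightMap_mem_solutionSpace huv hX
  have hmap : Module.finrank ℝ (D.map (heightMap V)) = Module.finrank ℝ D := by
    rw [← LinearMap.range_domRestrict]
    exact LinearMap.finrank_range_of_inj hinj
  have hsol := finrank_solutionSpace (G := G) (fun S => (huv S).1) fun S => (huv S).2.1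
  have hcard := hb.fintype_card_le_finrank
  have hle' := Submodule.finrank_mono hle
  rw [Nat.card_eq_fintype_card] at hsol
  refine ⟨⟨Module.Basis.mk hb (hb.span_eq_top_of_card_eq_finrank' (by omega)).ge, fun K => ?_⟩,
    Submodule.eq_of_le_of_finrank_eq hle (by omega)⟩
  rw [Module.Basis.mk_apply]

end Equations

theorem mainTheorem2 {V : Type*} [Fintype V] [DecidableEq V] (G : SimpleGraph V) :
    -- the dimension is the number of non-empty induced cliques
    Module.rank ℝ (virtualDeformations (graphicalZonotope G)) =
      (Nat.card {K : Finset V // K.Nonempty ∧ G.IsClique (K : Set V)} : Cardinal) ∧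
    -- the corresponding faces of the standard simplex form a basis
    (∃ b : Module.Basis {K : Finset V // K.Nonempty ∧ G.IsClique (K : Set V)} ℝ
        (virtualDeformations (graphicalZonotope G)),
      ∀ K, (b K : VirtualPolytope (V → ℝ)) = VirtualPolytope.of (simplexFace K.1 K.2.1)) ∧
    -- for any choice of one missing edge in each non-clique
    (∀ u v : {S : Finset V // ¬ G.IsClique (S : Set V)} → V,
      (∀ S, u S ∈ S.1 ∧ v S ∈ S.1 ∧ u S ≠ v S ∧ ¬ G.Adj (u S) (v S)) →
      -- the equations are linearly independent,
      LinearIndependent ℝ (equationForm G u v) ∧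
      -- every solution `h` defines a unique virtual polytope `P_h`,
      (∀ h : Finset V → ℝ,
        (h ∅ = -h Finset.univ ∧
          ∀ S : {S : Finset V // ¬ G.IsClique (S : Set V)},
            h (S.1 \ {u S}) + h (S.1 \ {v S}) = h S.1 + h (S.1 \ {u S, v S})) →
        ∃! X, IsVirtualOfHeights h X) ∧
      -- the virtual deformations are the `P_h` for all solutions `h`,
      (virtualDeformations (graphicalZonotope G) : Set (VirtualPolytope (V → ℝ))) =
        {X | ∃ h : Finset V → ℝ,
          (h ∅ = -h Finset.univ ∧
            ∀ S : {S : Finset V // ¬ G.IsClique (S : Set V)},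
              h (S.1 \ {u S}) + h (S.1 \ {v S}) = h S.1 + h (S.1 \ {u S, v S})) ∧
          IsVirtualOfHeights h X} ∧
      -- and each of them determines its height vector
      ∀ X ∈ virtualDeformations (graphicalZonotope G), ∃! h, IsVirtualOfHeights h X) := by
  refine ⟨?_, ?_, fun u v huv => ⟨?_, fun h hh => ?_, ?_, fun X hX => ?_⟩⟩
  · choose u v huv using exists_nonadjacent_of_not_isClique (G := G)
    obtain ⟨b, -⟩ := (exists_basis_virtualDeformations huv).1
    rw [← b.mk_eq_rank'', Nat.cast_card]
  · choose u v huv using exists_nonadjacent_of_not_isClique (G := G)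
    exact (exists_basis_virtualDeformations huv).1
  · exact linearIndependent_equationForm (fun S => (huv S).1) fun S => (huv S).2.1
  · rw [← mem_solutionSpace, ← (exists_basis_virtualDeformations huv).2] at hh
    obtain ⟨X, hX, rfl⟩ := hh
    have hX' := isVirtualOfHeights_heightMap (virtualDeformations_le_permutahedron G hX)
    exact ⟨X, hX', fun Y hY => hY.unique hX'⟩
  · ext X
    simp only [SetLike.mem_coe, Set.mem_ofPred_eq, ← mem_solutionSpace]
    constructor
    · exact fun hX => ⟨heightMap V X, heightMap_mem_solutionSpace huv hX,
        isVirtualOfHeights_heightMap (virtualDeformations_le_permutahedron G hX)⟩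
    · rintro ⟨h, hh, hX⟩
      rw [← (exists_basis_virtualDeformations huv).2] at hh
      obtain ⟨Y, hY, rfl⟩ := hh
      rwa [hX.unique (isVirtualOfHeights_heightMap (virtualDeformations_le_permutahedron G hY))]
  · exact ⟨heightMap V X,
      isVirtualOfHeights_heightMap (virtualDeformations_le_permutahedron G hX),
      fun h hh => hh.heightMap_eq.symm⟩
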